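/- Let $d\in\mathbb{N}$ and let $U:\mathbb{R}^d\to\mathbb{R}$ be the potential of the positive target density $\pi\propto e^{-U}$. Assume: (H1) $U$ is twice continuously differentiable, $\nabla U(0)=0$, and $L\ge 0$ is such that $\sup_{x\in\mathbb{R}^d}\|\mathrm{D}^2U(x)\|\le L$; (H3) there exist $\mathtt{m}>0$ and $\mathtt{K}\ge 0$ such that $\mathrm{D}^2U(x)\{y\}^{\otimes 2}\ge \mathtt{m}$ for all $x,y\in\mathbb{R}^d$ with $\|x\|\ge \mathtt{K}$ and $\|y\|=1$. For $\gamma>0$ let $$r_\gamma(x,y)=(4\pi\gamma)^{-d/2}\exp\bigl(-(4\gamma)^{-1}\|y-x+\gamma\nabla U(x)\|^2\bigr),\qquad \alpha_\gamma(x,y)=1\wedge\frac{e^{-U(y)}\,r_\gamma(y,x)}{e^{-U(x)}\,r_\gamma(x,y)}$$ (in the prefactor of $r_\gamma$, $\pi$ is the number $3.14\ldots$), and let $R_\gamma$ be the Markov kernel of the Metropolis Adjusted Langevin Algorithm (MALA), $$R_\gamma(x,\mathsf{A})=\int_{\mathsf{A}}\alpha_\gamma(x,y)r_\gamma(x,y)\,\mathrm{d}y+\delta_x(\mathsf{A})\int_{\mathbb{R}^d}\{1-\alpha_\gamma(x,y)\}r_\gamma(x,y)\,\mathrm{d}y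 .$$ For a finite signed measure $\mu$ let $\|\mu\|_{\mathrm{TV}}=\sup\{|\int f\,\mathrm{d}\mu| : f \text{ measurable},\ \sup|f|\le 1\}$, let $\boldsymbol{\Phi}$ be the standard Gaussian distribution function on $\mathbb{R}$, and for $K\ge0$ put $$\varepsilon(K)=2\boldsymbol{\Phi}\bigl(-(1+1/L)^{1/2}(3L)^{1/2}K\bigr).$$ Then for every $K\ge 0$ there exists $\tilde\Gamma_K>0$ such that for all $x,y\in\mathbb{R}^d$ with $\|x\|\vee\|y\|\le K$ and all $\gamma\in(0,\tilde\Gamma_K]$, $$\bigl\|\delta_xR_\gamma^{\lceil 1/\gamma\rceil}-\delta_yR_\gamma^{\lceil 1/\gamma\rceil}\bigr\|_{\mathrm{TV}}\le 2\bigl(1-\varepsilon(K)/2\bigr).$$ (For $d\ge1$, (H1) and (H3) force $L\ge \mathtt{m}>0$; for $d=0$ the claim is trivial, with the convention $1/L=0$ if $L=0$.) -/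

import Mathlib

open MeasureTheory ProbabilityTheory

noncomputable section

namespace MALA

/-- Euclidean space `ℝ^d`. -/
abbrev E (d : ℕ) : Type := EuclideanSpace ℝ (Fin d)

/-- Regularity of the potential: `U` is twice continuously differentiable, `∇U(0) = 0`, `L ≥ 0` and
`‖D²U(x)‖ ≤ L` for every `x` (operator norm of the bilinear form `D²U(x)`). -/
structure RegularPotential {d : ℕ} (U : E d → ℝ) (L : ℝ) : Prop where
  contDiff : ContDiff ℝ 2 U
  gradient_zero : gradient U 0 = 0
  nonneg : 0 ≤ L
  norm_hessian_le : ∀ x : E d, ‖iteratedFDeriv ℝ 2 U x‖ ≤ L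

/-- Strong convexity outside a ball: there are `m > 0` and `K ≥ 0` such that
`D²U(x)[y, y] ≥ m` whenever `‖x‖ ≥ K` and `‖y‖ = 1`. -/
def CurvatureAtInfinity {d : ℕ} (U : E d → ℝ) : Prop :=
  ∃ m K : ℝ, 0 < m ∧ 0 ≤ K ∧
    ∀ x y : E d, K ≤ ‖x‖ → ‖y‖ = 1 → m ≤ iteratedFDeriv ℝ 2 U x ![y, y]

/-- The target density `π = exp(-U)`, that is, `U = -log π`. A normalizing constant
would cancel in the acceptance ratio. -/
def targetDensity {d : ℕ} (U : E d → ℝ) (x : E d) : ℝ := Real.exp (-U x)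

/-- The proposal density
`r_γ(x, y) = (4πγ)^(-d/2) exp(-(4γ)⁻¹ ‖y - x + γ ∇U(x)‖²)` of the Euler-Maruyama scheme. -/
def proposalDensity {d : ℕ} (U : E d → ℝ) (γ : ℝ) (x y : E d) : ℝ :=
  (4 * Real.pi * γ) ^ (-(d : ℝ) / 2) *
    Real.exp (-(4 * γ)⁻¹ * ‖y - x + γ • gradient U x‖ ^ 2)

/-- The Metropolis acceptance probability
`α_γ(x, y) = 1 ∧ (π(y) r_γ(y, x)) / (π(x) r_γ(x, y))`. -/
def acceptance {d : ℕ} (U : E d → ℝ) (γ : ℝ) (x y : E d) : ℝ :=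
  min 1 ((targetDensity U y * proposalDensity U γ y x) /
    (targetDensity U x * proposalDensity U γ x y))

/-- The law of one MALA step from `x`:
`A ↦ ∫_A α_γ(x, y) r_γ(x, y) dy + δ_x(A) ∫ (1 - α_γ(x, y)) r_γ(x, y) dy`. -/
def stepLaw {d : ℕ} (U : E d → ℝ) (γ : ℝ) (x : E d) : Measure (E d) :=
  (volume : Measure (E d)).withDensity
      (fun y => ENNReal.ofReal (acceptance U γ x y * proposalDensity U γ x y)) +
    (∫⁻ y, ENNReal.ofReal ((1 - acceptance U γ x y) * proposalDensity U γ x y)) •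
      Measure.dirac x

theorem measurable_proposalDensity {d : ℕ} {U : E d → ℝ} (hU : ContDiff ℝ 2 U) (γ : ℝ) :
    Measurable (fun p : E d × E d => proposalDensity U γ p.1 p.2) := by
  have hg : Continuous (gradient U) :=
    (InnerProductSpace.toDual ℝ (E d)).symm.continuous.comp
      (hU.continuous_fderiv (by norm_num))
  have : Continuous (fun p : E d × E d => proposalDensity U γ p.1 p.2) := by
    unfold proposalDensity
    fun_prop
  exact this.measurable

theorem measurable_acceptance {d : ℕ} {U : E d → ℝ} (hU : ContDiff ℝ 2 U) (γ : ℝ) :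
    Measurable (fun p : E d × E d => acceptance U γ p.1 p.2) := by
  have hr := measurable_proposalDensity hU γ
  have hr' : Measurable (fun p : E d × E d => proposalDensity U γ p.2 p.1) := by
    have h := hr.comp (measurable_swap (α := E d) (β := E d))
    simpa only [Function.comp_def, Prod.fst_swap, Prod.snd_swap] using h
  have hπ : Measurable (targetDensity U) := by
    have h : Continuous (targetDensity U) := by
      have := hU.continuous
      unfold targetDensity
      fun_prop
    exact h.measurable
  have h1 : Measurable (fun p : E d × E d => targetDensity U p.2 * proposalDensity U γ p.2 p.1) :=
    (hπ.comp measurable_snd).mul hr'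
  have h2 : Measurable (fun p : E d × E d => targetDensity U p.1 * proposalDensity U γ p.1 p.2) :=
    (hπ.comp measurable_fst).mul hr
  unfold acceptance
  exact measurable_const.min (h1.div h2)

theorem measurable_stepLaw {d : ℕ} {U : E d → ℝ} (hU : ContDiff ℝ 2 U) (γ : ℝ) :
    Measurable (stepLaw U γ) := by
  have hr := measurable_proposalDensity hU γ
  have ha := measurable_acceptance hU γ
  refine Measure.measurable_of_measurable_coe _ fun s hs => ?_
  have h1 : Measurable fun x : E d =>
      ∫⁻ y in s, ENNReal.ofReal (acceptance U γ x y * proposalDensity U γ x y) :=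
    (ha.mul hr).ennreal_ofReal.lintegral_prod_right'
  have h2 : Measurable fun x : E d =>
      ∫⁻ y, ENNReal.ofReal ((1 - acceptance U γ x y) * proposalDensity U γ x y) :=
    ((measurable_const.sub ha).mul hr).ennreal_ofReal.lintegral_prod_right'
  have h3 : Measurable fun x : E d => Measure.dirac x s :=
    (Measure.measurable_coe hs).comp Measure.measurable_dirac
  simp only [stepLaw, Measure.add_apply, Measure.smul_apply, smul_eq_mul,
    withDensity_apply _ hs]
  exact h1.add (h2.mul h3)

/-- The Markov kernel `R_γ` of MALA. -/
def malaKernel {d : ℕ} (U : E d → ℝ) (hU : ContDiff ℝ 2 U) (γ : ℝ) : Kernel (E d) (E d) :=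
  ⟨stepLaw U γ, measurable_stepLaw hU γ⟩

/-- The total variation norm of `μ - ν` for finite measures `μ`, `ν`, in the convention
`‖μ - ν‖_TV = sup { |∫ f dμ - ∫ f dν| : f measurable, ‖f‖_∞ ≤ 1 }`
(so it is at most `2` for probability measures). -/
def tvNormSub {X : Type*} [MeasurableSpace X] (μ ν : Measure X) : ℝ :=
  ⨆ f : {f : X → ℝ // Measurable f ∧ ∀ x, |f x| ≤ 1}, |∫ x, f.1 x ∂μ - ∫ x, f.1 x ∂ν|

/-- `ε(K) = 2 Φ(-(1 + 1/L)^(1/2) (3L)^(1/2) K)`, where `Φ` is the distribution function of the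
standard Gaussian law. -/
def eps (L K : ℝ) : ℝ :=
  2 * cdf (gaussianReal 0 1) (-(Real.sqrt (1 + 1 / L) * Real.sqrt (3 * L) * K))

end MALA

end

/-! The unadjusted Langevin chain, which accepts every proposal, has an explicit overlap after unit
time. For small `γ`, MALA differs from it by an arbitrarily small error over that time. The claimed
constant is strictly smaller than the overlap when `K > 0`, and this gap absorbs the error.

Overlap is handled by duality: bound `∫ F dμ + ∫ G dν` from below over test functions with `F + G ≥
1`. By Cauchy-Schwarz, one Gaussian step carries a lower bound on `√F + √G` backwards in time at the
cost of a Hellinger affinity `exp(-‖b - a‖² / (16γ))` (`overlap_ulaOp`). Each step removes part of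
the distance between the starting points by a translation; optimizing that part gives a closed
recursion (`overlap_ulaOp_iterate`). After unit time, `‖x‖, ‖y‖ ≤ K` yields an overlap of at least
`exp(-(L+1)K²) / 2`.

For the comparison, the log acceptance ratio is a trapezoidal error for `U` plus a difference of
squared gradients (`acceptance_eq`). The trapezoidal error is `o(‖y - x‖²)` on bounded sets, as
`D²U` is uniformly continuous there; far out, a crude bound suffices, since the weight `1 + ‖x‖²` is
large. Hence rejection has probability at most `η γ (1 + ‖x‖²)` for any `η > 0` and small `γ`
(`exists_rejection_le`). Second moments stay bounded over about `1/γ` steps, so the accumulated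
error is `O(η)` (`ulaOp_iterate_le`).

The Gaussian tail bound gives `ε(K)/2 ≤ exp(-(3/2)(L+1)K²) / 2`, strictly below the overlap for `K >
0`. Curvature at infinity enters only to give `L > 0` when `d ≠ 0`. -/

open scoped ENNReal

namespace MALA

variable {d : ℕ}

/-! ### Gaussian densities and their moments -/

/-- Density of the centred Gaussian law with covariance `2γ I` on `ℝ^d`. -/
noncomputable def heat (γ : ℝ) (w : E d) : ℝ :=
  (4 * Real.pi * γ) ^ (-(d : ℝ) / 2) * Real.exp (-(4 * γ)⁻¹ * ‖w‖ ^ 2)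

/-- One Euler step `x - γ ∇U(x)` of the gradient flow. -/
noncomputable def drift (U : E d → ℝ) (γ : ℝ) (x : E d) : E d := x - γ • gradient U x

theorem proposalDensity_eq_heat (U : E d → ℝ) (γ : ℝ) (x y : E d) :
    proposalDensity U γ x y = heat γ (y - drift U γ x) := by
  unfold proposalDensity heat drift
  rw [show y - (x - γ • gradient U x) = y - x + γ • gradient U x by abel]

theorem continuous_heat (γ : ℝ) : Continuous (heat γ : E d → ℝ) := by
  unfold heat; fun_prop

theorem measurable_ofReal_heat (γ : ℝ) :
    Measurable fun w : E d => ENNReal.ofReal (heat γ w) :=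
  (continuous_heat γ).measurable.ennreal_ofReal

theorem heat_pos {γ : ℝ} (hγ : 0 < γ) (w : E d) : 0 < heat γ w := by
  unfold heat; positivity

theorem heat_neg (γ : ℝ) (w : E d) : heat γ (-w) = heat γ w := by simp [heat]

theorem lintegral_heat {γ : ℝ} (hγ : 0 < γ) :
    ∫⁻ w : E d, ENNReal.ofReal (heat γ w) = 1 := by
  have hb : 0 < (4 * γ)⁻¹ := by positivity
  have hint := GaussianFourier.integral_rexp_neg_mul_sq_norm (V := E d) hb
  have hc : 0 < 4 * Real.pi * γ := by positivity
  have h1 : ∫ w : E d, heat γ w = 1 := by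
    unfold heat
    rw [integral_const_mul, hint, finrank_euclideanSpace_fin, div_inv_eq_mul,
      show Real.pi * (4 * γ) = 4 * Real.pi * γ by ring, ← Real.rpow_add hc]
    simp [neg_div]
  have h2 : Integrable (heat γ : E d → ℝ) := by
    by_contra h
    rw [integral_undef h] at h1
    exact zero_ne_one h1
  rw [← ofReal_integral_eq_lintegral_ofReal h2
    (Filter.Eventually.of_forall fun w => (heat_pos hγ w).le), h1, ENNReal.ofReal_one]

/-- Half of the Gaussian exponent is set aside to absorb powers of `‖w‖`. Moments then reduce to the
total mass of the density with parameter `2 * γ`. -/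
theorem heat_two_mul {γ : ℝ} (hγ : 0 < γ) (w : E d) :
    heat γ w = 2 ^ ((d : ℝ) / 2) * Real.exp (-(8 * γ)⁻¹ * ‖w‖ ^ 2) * heat (2 * γ) w := by
  unfold heat
  have hc : 0 < 4 * Real.pi * γ := by positivity
  rw [show 4 * Real.pi * (2 * γ) = 2 * (4 * Real.pi * γ) by ring,
    Real.mul_rpow (by norm_num) hc.le, neg_div, Real.rpow_neg (by norm_num : (0 : ℝ) ≤ 2)]
  have h2 : (2 : ℝ) ^ ((d : ℝ) / 2) ≠ 0 := by positivity
  have : Real.exp (-(4 * γ)⁻¹ * ‖w‖ ^ 2) =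
      Real.exp (-(8 * γ)⁻¹ * ‖w‖ ^ 2) * Real.exp (-(4 * (2 * γ))⁻¹ * ‖w‖ ^ 2) := by
    rw [← Real.exp_add]
    congr 1
    field_simp
    ring
  rw [this]
  field_simp

theorem sq_mul_heat_le {γ : ℝ} (hγ : 0 < γ) (w : E d) :
    ‖w‖ ^ 2 * heat γ w ≤ 8 * 2 ^ ((d : ℝ) / 2) * γ * heat (2 * γ) w := by
  rw [heat_two_mul hγ]
  have hh := heat_pos (show 0 < 2 * γ by positivity) w
  have h2 : 0 < (2 : ℝ) ^ ((d : ℝ) / 2) := by positivity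
  set s := (8 * γ)⁻¹ * ‖w‖ ^ 2 with hs
  have hw : ‖w‖ ^ 2 = 8 * γ * s := by rw [hs]; field_simp
  have he : s * Real.exp (-s) ≤ 1 := by
    rw [Real.exp_neg, ← div_eq_mul_inv, div_le_one (Real.exp_pos _)]
    linarith [Real.add_one_le_exp s]
  rw [neg_mul, ← hs, hw]
  calc 8 * γ * s * (2 ^ ((d : ℝ) / 2) * Real.exp (-s) * heat (2 * γ) w)
      = (8 * 2 ^ ((d : ℝ) / 2) * γ * heat (2 * γ) w) * (s * Real.exp (-s)) := by ring
    _ ≤ (8 * 2 ^ ((d : ℝ) / 2) * γ * heat (2 * γ) w) * 1 := by gcongr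
    _ = _ := mul_one _

theorem pow_four_mul_heat_le {γ : ℝ} (hγ : 0 < γ) (w : E d) :
    ‖w‖ ^ 4 * heat γ w ≤ 128 * 2 ^ ((d : ℝ) / 2) * γ ^ 2 * heat (2 * γ) w := by
  rw [heat_two_mul hγ]
  have hh := heat_pos (show 0 < 2 * γ by positivity) w
  have h2 : 0 < (2 : ℝ) ^ ((d : ℝ) / 2) := by positivity
  set s := (8 * γ)⁻¹ * ‖w‖ ^ 2 with hs
  have hs0 : 0 ≤ s := by positivity
  have hw : ‖w‖ ^ 4 = 64 * γ ^ 2 * s ^ 2 := by rw [hs]; field_simp; ring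
  have he : s ^ 2 / 2 * Real.exp (-s) ≤ 1 := by
    rw [Real.exp_neg, ← div_eq_mul_inv, div_le_one (Real.exp_pos _)]
    linarith [Real.quadratic_le_exp_of_nonneg hs0]
  rw [neg_mul, ← hs, hw]
  calc 64 * γ ^ 2 * s ^ 2 * (2 ^ ((d : ℝ) / 2) * Real.exp (-s) * heat (2 * γ) w)
      = (128 * 2 ^ ((d : ℝ) / 2) * γ ^ 2 * heat (2 * γ) w) * (s ^ 2 / 2 * Real.exp (-s)) := by ring
    _ ≤ (128 * 2 ^ ((d : ℝ) / 2) * γ ^ 2 * heat (2 * γ) w) * 1 := by gcongr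
    _ = _ := mul_one _

/-- Integrals of quartic polynomials in `‖w‖` against the Gaussian density. -/
theorem lintegral_quartic_mul_heat_le {γ a b c : ℝ} (hγ : 0 < γ) (ha : 0 ≤ a) (hb : 0 ≤ b)
    (hc : 0 ≤ c) :
    ∫⁻ w : E d, ENNReal.ofReal ((a + b * ‖w‖ ^ 2 + c * ‖w‖ ^ 4) * heat γ w) ≤
      ENNReal.ofReal (a + b * (8 * 2 ^ ((d : ℝ) / 2) * γ) +
        c * (128 * 2 ^ ((d : ℝ) / 2) * γ ^ 2)) := by
  have h2 : 0 < (2 : ℝ) ^ ((d : ℝ) / 2) := by positivity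
  set B := b * (8 * 2 ^ ((d : ℝ) / 2) * γ) + c * (128 * 2 ^ ((d : ℝ) / 2) * γ ^ 2) with hB
  have hB0 : 0 ≤ B := by positivity
  have hγ2 : 0 < 2 * γ := by positivity
  calc ∫⁻ w : E d, ENNReal.ofReal ((a + b * ‖w‖ ^ 2 + c * ‖w‖ ^ 4) * heat γ w)
      ≤ ∫⁻ w : E d, (ENNReal.ofReal a * ENNReal.ofReal (heat γ w) +
          ENNReal.ofReal B * ENNReal.ofReal (heat (2 * γ) w)) := by
        refine lintegral_mono fun w => ?_
        have h0 := heat_pos hγ w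
        have h1 := heat_pos hγ2 w
        rw [← ENNReal.ofReal_mul ha, ← ENNReal.ofReal_mul hB0,
          ← ENNReal.ofReal_add (by positivity) (by positivity)]
        refine ENNReal.ofReal_le_ofReal ?_
        have e1 := mul_le_mul_of_nonneg_left (sq_mul_heat_le hγ w) hb
        have e2 := mul_le_mul_of_nonneg_left (pow_four_mul_heat_le hγ w) hc
        rw [hB]
        linarith
    _ = ENNReal.ofReal (a + B) := by
        rw [lintegral_add_left ((measurable_ofReal_heat γ).const_mul _),
          lintegral_const_mul _ (measurable_ofReal_heat γ),
          lintegral_const_mul _ (measurable_ofReal_heat _), lintegral_heat hγ, lintegral_heat hγ2,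
          mul_one, mul_one, ENNReal.ofReal_add ha hB0]
    _ = _ := by rw [hB, add_assoc]

/-- Change of variables `y = drift x + w` in the proposal density. -/
theorem lintegral_proposalDensity (U : E d → ℝ) (γ : ℝ) (x : E d) (F : E d → ℝ≥0∞) :
    ∫⁻ y, F y * ENNReal.ofReal (proposalDensity U γ x y) =
      ∫⁻ w, F (drift U γ x + w) * ENNReal.ofReal (heat γ w) := by
  rw [← lintegral_add_left_eq_self _ (drift U γ x)]
  simp only [proposalDensity_eq_heat, add_sub_cancel_left]

/-! ### The trapezoidal rule -/

/-- The trapezoidal rule is exact for quadratics, so only the deviation of `g''` from a constant `k`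
matters. The choice `k = 0` gives the global bound, `k` equal to the second derivative at the
starting point the local one. -/
theorem abs_trapezoid_le {g g' g'' : ℝ → ℝ} {k ε : ℝ}
    (h1 : ∀ t, HasDerivAt g (g' t) t) (h2 : ∀ t, HasDerivAt g' (g'' t) t)
    (h : ∀ t ∈ Set.Icc (0 : ℝ) 1, |g'' t - k| ≤ ε) :
    |g 0 - g 1 + (g' 0 + g' 1) / 2| ≤ 2 * ε := by
  have hε : 0 ≤ ε := (abs_nonneg _).trans (h 0 (by simp))
  have hA : ∀ t ∈ Set.Icc (0 : ℝ) 1, |g' t - g' 0 - k * t| ≤ ε * t := by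
    intro t ht
    have := norm_image_sub_le_of_norm_deriv_le_segment' (f := fun t => g' t - k * t)
      (f' := fun t => g'' t - k) (a := 0) (b := 1) (C := ε)
      (fun s _ => by
        simpa using! ((h2 s).sub ((hasDerivAt_id s).const_mul k)).hasDerivWithinAt)
      (fun s hs => h s ⟨hs.1, hs.2.le⟩) t ht
    simpa [Real.norm_eq_abs, sub_right_comm] using this
  have hB : |(g 1 - k * 1 ^ 2 / 2 - g' 0 * 1) - (g 0 - k * 0 ^ 2 / 2 - g' 0 * 0)| ≤ ε := by
    refine norm_image_sub_le_of_norm_deriv_le_segment_01'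
      (f := fun t => g t - k * t ^ 2 / 2 - g' 0 * t) (f' := fun t => g' t - k * t - g' 0) ?_ ?_
    · intro t _
      have := ((h1 t).sub ((((hasDerivAt_id t).pow 2).const_mul k).div_const 2)).sub
        ((hasDerivAt_id t).const_mul (g' 0))
      refine (this.congr_deriv ?_).hasDerivWithinAt
      simp
      ring
    · intro t ht
      have h3 := hA t ⟨ht.1, ht.2.le⟩
      rw [Real.norm_eq_abs, show g' t - k * t - g' 0 = g' t - g' 0 - k * t by ring]
      exact h3.trans (by nlinarith [ht.2])
  have hC := hA 1 (by simp)
  rw [abs_le] at hB hC ⊢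
  constructor <;> linarith [hB.1, hB.2, hC.1, hC.2]

theorem inner_gradient {U : E d → ℝ} (x v : E d) :
    inner ℝ (gradient U x) v = fderiv ℝ U x v := by
  simp [gradient]

/-- Error of the trapezoidal rule for `U y - U x` along the segment from `x` to `y`. -/
noncomputable def trapezoidError (U : E d → ℝ) (x y : E d) : ℝ :=
  U x - U y + inner ℝ (gradient U x + gradient U y) (y - x) / 2

theorem abs_trapezoidError_le {U : E d → ℝ} (hU : ContDiff ℝ 2 U) {x y : E d}
    (k : E d →L[ℝ] E d →L[ℝ] ℝ) {ε : ℝ}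
    (h : ∀ t ∈ Set.Icc (0 : ℝ) 1, ‖fderiv ℝ (fderiv ℝ U) (x + t • (y - x)) - k‖ ≤ ε) :
    |trapezoidError U x y| ≤ 2 * ε * ‖y - x‖ ^ 2 := by
  have hd1 : Differentiable ℝ U := hU.differentiable (by norm_num)
  have hd2 : Differentiable ℝ (fderiv ℝ U) :=
    (hU.fderiv_right (m := 1) (by norm_num)).differentiable (by norm_num)
  have hline : ∀ t : ℝ, HasDerivAt (fun t : ℝ => x + t • (y - x)) (y - x) t := fun t => by
    simpa using! ((hasDerivAt_id t).smul_const (y - x)).const_add x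
  have h1 : ∀ t : ℝ, HasDerivAt (fun t : ℝ => U (x + t • (y - x)))
      (fderiv ℝ U (x + t • (y - x)) (y - x)) t := fun t =>
    (hd1 _).hasFDerivAt.comp_hasDerivAt t (hline t)
  have h2 : ∀ t : ℝ, HasDerivAt (fun t : ℝ => fderiv ℝ U (x + t • (y - x)) (y - x))
      (fderiv ℝ (fderiv ℝ U) (x + t • (y - x)) (y - x) (y - x)) t := fun t =>
    (((hd2 _).hasFDerivAt.comp_hasDerivAt t (hline t)).clm_apply
      (hasDerivAt_const t (y - x))).congr_deriv (by simp)
  have key := abs_trapezoid_le (k := k (y - x) (y - x)) (ε := ε * ‖y - x‖ ^ 2) h1 h2 ?_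
  · rw [trapezoidError, inner_add_left, inner_gradient, inner_gradient]
    simp only [zero_smul, add_zero, one_smul, add_sub_cancel] at key
    linarith
  · intro t ht
    have e := (fderiv ℝ (fderiv ℝ U) (x + t • (y - x)) - k).le_opNorm₂ (y - x) (y - x)
    rw [Real.norm_eq_abs] at e
    refine e.trans ?_
    rw [mul_assoc, ← sq]
    exact mul_le_mul_of_nonneg_right (h t ht) (by positivity)

namespace RegularPotential

variable {U : E d → ℝ} {L : ℝ}

theorem norm_fderiv_fderiv_le (hU : RegularPotential U L) (x : E d) :
    ‖fderiv ℝ (fderiv ℝ U) x‖ ≤ L := by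
  have := hU.norm_hessian_le x
  rwa [show (2 : ℕ) = 1 + 1 from rfl, ← norm_iteratedFDeriv_fderiv, norm_iteratedFDeriv_one] at this

theorem norm_gradient_sub_le (hU : RegularPotential U L) (x y : E d) :
    ‖gradient U y - gradient U x‖ ≤ L * ‖y - x‖ := by
  have hd2 : Differentiable ℝ (fderiv ℝ U) :=
    (hU.contDiff.fderiv_right (m := 1) (by norm_num)).differentiable (by norm_num)
  have := convex_univ.norm_image_sub_le_of_norm_fderiv_le (𝕜 := ℝ) (f := fderiv ℝ U) (x := x)
    (y := y) (fun z _ => hd2 z) (fun z _ => hU.norm_fderiv_fderiv_le z) trivial trivial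
  unfold gradient
  rwa [← map_sub, LinearIsometryEquiv.norm_map]

theorem norm_gradient_le (hU : RegularPotential U L) (x : E d) : ‖gradient U x‖ ≤ L * ‖x‖ := by
  simpa [hU.gradient_zero] using hU.norm_gradient_sub_le 0 x

theorem norm_drift_sub_le (hU : RegularPotential U L) {γ : ℝ} (hγ : 0 ≤ γ) (x y : E d) :
    ‖drift U γ y - drift U γ x‖ ≤ (1 + γ * L) * ‖y - x‖ := by
  have : drift U γ y - drift U γ x = (y - x) - γ • (gradient U y - gradient U x) := by
    simp only [drift, smul_sub]; abel
  rw [this]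
  refine (norm_sub_le _ _).trans ?_
  rw [norm_smul, Real.norm_of_nonneg hγ]
  nlinarith [hU.norm_gradient_sub_le x y, mul_le_mul_of_nonneg_left
    (hU.norm_gradient_sub_le x y) hγ]

theorem drift_zero (hU : RegularPotential U L) (γ : ℝ) : drift U γ 0 = 0 := by
  simp [drift, hU.gradient_zero]

theorem norm_drift_le (hU : RegularPotential U L) {γ : ℝ} (hγ : 0 ≤ γ) (x : E d) :
    ‖drift U γ x‖ ≤ (1 + γ * L) * ‖x‖ := by
  simpa [hU.drift_zero] using hU.norm_drift_sub_le hγ 0 x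

theorem abs_trapezoidError_le (hU : RegularPotential U L) (x y : E d) :
    |trapezoidError U x y| ≤ 2 * L * ‖y - x‖ ^ 2 :=
  MALA.abs_trapezoidError_le hU.contDiff 0 fun t _ => by
    simpa using hU.norm_fderiv_fderiv_le _

/-- On a bounded set the error of the trapezoidal rule is `o(‖y - x‖²)`, uniformly. -/
theorem exists_abs_trapezoidError_le (hU : RegularPotential U L) (M : ℝ) {δ : ℝ} (hδ : 0 < δ) :
    ∃ C : ℝ, 0 ≤ C ∧ ∀ x y : E d, ‖x‖ ≤ M →
      |trapezoidError U x y| ≤ δ * ‖y - x‖ ^ 2 + C * ‖y - x‖ ^ 4 := by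
  have hc : Continuous (fderiv ℝ (fderiv ℝ U)) :=
    (hU.contDiff.fderiv_right (m := 1) (by norm_num)).continuous_fderiv (by norm_num)
  obtain ⟨ρ, hρ, hρ'⟩ := (Metric.uniformContinuousOn_iff (f := fderiv ℝ (fderiv ℝ U))).1
    ((isCompact_closedBall (0 : E d) (M + 1)).uniformContinuousOn_of_continuous
      hc.continuousOn) (δ / 2) (by positivity)
  -- The cap at 1 keeps the whole segment in the ball of radius `M + 1`, where the Hessian is
  -- uniformly continuous; `ρ / 2` makes the distance strictly less than `ρ`.
  set ρ' := min (ρ / 2) 1 with hρ'd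
  have hρ0 : 0 < ρ' := by positivity
  refine ⟨2 * L / ρ' ^ 2, div_nonneg (mul_nonneg zero_le_two hU.nonneg) (by positivity),
    fun x y hx => ?_⟩
  have hL := hU.nonneg
  rcases le_total ‖y - x‖ ρ' with h | h
  · have := MALA.abs_trapezoidError_le hU.contDiff (x := x) (y := y)
      (fderiv ℝ (fderiv ℝ U) x) (ε := δ / 2) fun t ht => by
        have ht' : ‖t • (y - x)‖ ≤ ρ' := by
          rw [norm_smul, Real.norm_of_nonneg ht.1]
          exact (mul_le_of_le_one_left (norm_nonneg _) ht.2).trans h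
        refine (dist_eq_norm (fderiv ℝ (fderiv ℝ U) (x + t • (y - x)))
          (fderiv ℝ (fderiv ℝ U) x)).symm.trans_le (hρ' _ ?_ _ ?_ ?_).le
        · rw [mem_closedBall_zero_iff]
          exact (norm_add_le _ _).trans (add_le_add hx (ht'.trans (min_le_right _ _)))
        · rw [mem_closedBall_zero_iff]; linarith
        · rw [dist_eq_norm, add_sub_cancel_left]
          linarith [min_le_left (ρ / 2) 1]
    have h0 : 0 ≤ 2 * L / ρ' ^ 2 * ‖y - x‖ ^ 4 := by positivity
    linarith
  · refine (hU.abs_trapezoidError_le x y).trans ?_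
    have h0 : 0 ≤ δ * ‖y - x‖ ^ 2 := by positivity
    -- Away from the diagonal, `1 ≤ ‖y - x‖² / ρ'²` turns the crude quadratic bound into a quartic
    -- one.
    have h1 : 2 * L * ‖y - x‖ ^ 2 ≤ 2 * L / ρ' ^ 2 * ‖y - x‖ ^ 4 := by
      rw [div_mul_eq_mul_div, le_div_iff₀ (by positivity),
          show ‖y - x‖ ^ 4 = ‖y - x‖ ^ 2 * ‖y - x‖ ^ 2 by ring,
        ← mul_assoc]
      gcongr
    linarith

end RegularPotential

/-! ### Acceptance ratio and rejection probability -/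

/-- The logarithm of the Metropolis-Hastings ratio of MALA. -/
theorem acceptance_eq (U : E d → ℝ) {γ : ℝ} (hγ : 0 < γ) (x y : E d) :
    acceptance U γ x y = min 1 (Real.exp (trapezoidError U x y +
      γ / 4 * (‖gradient U x‖ ^ 2 - ‖gradient U y‖ ^ 2))) := by
  have hc : (4 * Real.pi * γ) ^ (-(d : ℝ) / 2) ≠ 0 := by positivity
  unfold acceptance targetDensity proposalDensity
  congr 1
  rw [mul_left_comm, mul_left_comm (Real.exp (-U x)), mul_div_mul_left _ _ hc, ← Real.exp_add,
    ← Real.exp_add, ← Real.exp_sub]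
  congr 1
  -- In the difference of the expanded squares `‖y - x‖²` cancels, the cross terms form the
  -- trapezoidal sum, and the squared gradients keep a factor `γ / 4`.
  have h1 := norm_add_sq_real (y - x) (γ • gradient U x)
  have h2 := norm_add_sq_real (x - y) (γ • gradient U y)
  rw [norm_smul, Real.norm_of_nonneg hγ.le, inner_smul_right, real_inner_comm] at h1 h2
  rw [h1, h2, trapezoidError, inner_add_left, ← neg_sub y x, norm_neg, inner_neg_right]
  field_simp
  ring

theorem acceptance_nonneg (U : E d → ℝ) {γ : ℝ} (hγ : 0 < γ) (x y : E d) :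
    0 ≤ acceptance U γ x y := by
  rw [acceptance_eq U hγ]; positivity

theorem acceptance_le_one (U : E d → ℝ) (γ : ℝ) (x y : E d) : acceptance U γ x y ≤ 1 :=
  min_le_left _ _

/-- This is `1 - min 1 (exp a) ≤ |a|`, a consequence of `1 + a ≤ exp a`. -/
theorem one_sub_acceptance_le (U : E d → ℝ) {γ : ℝ} (hγ : 0 < γ) (x y : E d) :
    1 - acceptance U γ x y ≤ |trapezoidError U x y| +
      γ / 4 * |‖gradient U x‖ ^ 2 - ‖gradient U y‖ ^ 2| := by
  rw [acceptance_eq U hγ, ← abs_of_pos (show 0 < γ / 4 by positivity), ← abs_mul,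
    abs_of_pos (show 0 < γ / 4 by positivity)]
  refine le_trans ?_ (abs_add_le _ _)
  set a := trapezoidError U x y + γ / 4 * (‖gradient U x‖ ^ 2 - ‖gradient U y‖ ^ 2)
  rcases min_cases 1 (Real.exp a) with ⟨h, _⟩ | ⟨h, _⟩ <;> rw [h]
  · simp
  · linarith [Real.add_one_le_exp a, neg_abs_le a]

variable {U : E d → ℝ} {L : ℝ}

/-- The probability that MALA rejects the proposal made from `x`. -/
noncomputable def rejection (U : E d → ℝ) (γ : ℝ) (x : E d) : ℝ≥0∞ :=
  ∫⁻ y, ENNReal.ofReal ((1 - acceptance U γ x y) * proposalDensity U γ x y)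

/-- The transition operator of the unadjusted Langevin algorithm. -/
noncomputable def ulaOp (U : E d → ℝ) (γ : ℝ) (F : E d → ℝ≥0∞) (x : E d) : ℝ≥0∞ :=
  ∫⁻ y, F y * ENNReal.ofReal (proposalDensity U γ x y)

/-- The increment `y - x` is Gaussian noise minus `γ • gradient U x`, so its even powers split into
a drift part and a Gaussian moment. -/
theorem RegularPotential.rejection_le_of_forall (hU : RegularPotential U L) {γ : ℝ} (hγ : 0 < γ)
    {A B C : ℝ} (hA : 0 ≤ A) (hB : 0 ≤ B) (hC : 0 ≤ C) (x : E d)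
    (h : ∀ y, 1 - acceptance U γ x y ≤ A + B * ‖y - x‖ ^ 2 + C * ‖y - x‖ ^ 4) :
    rejection U γ x ≤ ENNReal.ofReal (A +
      B * (2 * (γ * L * ‖x‖) ^ 2 + 2 * (8 * 2 ^ ((d : ℝ) / 2) * γ)) +
      C * (8 * (γ * L * ‖x‖) ^ 4 + 8 * (128 * 2 ^ ((d : ℝ) / 2) * γ ^ 2))) := by
  have hL := hU.nonneg
  have h1 : rejection U γ x = ∫⁻ w, ENNReal.ofReal
      ((1 - acceptance U γ x (drift U γ x + w)) * heat γ w) := by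
    have := lintegral_proposalDensity U γ x
      (fun y => ENNReal.ofReal (1 - acceptance U γ x y))
    simpa only [rejection, ENNReal.ofReal_mul (sub_nonneg.2 (acceptance_le_one U γ _ _))]
      using this
  have hq := lintegral_quartic_mul_heat_le (d := d) hγ
    (show 0 ≤ A + B * (2 * (γ * L * ‖x‖) ^ 2) + C * (8 * (γ * L * ‖x‖) ^ 4) by positivity)
    (show 0 ≤ 2 * B by positivity) (show 0 ≤ 8 * C by positivity)
  rw [h1]
  refine (lintegral_mono fun w => ?_).trans (hq.trans_eq ?_)
  · refine ENNReal.ofReal_le_ofReal (mul_le_mul_of_nonneg_right ?_ (heat_pos hγ w).le)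
    refine (h _).trans ?_
    set r := ‖drift U γ x + w - x‖ with hr
    have hr0 : 0 ≤ r := norm_nonneg _
    have hle : r ≤ γ * L * ‖x‖ + ‖w‖ := by
      rw [hr, show drift U γ x + w - x = w - γ • gradient U x by unfold drift; abel]
      refine (norm_sub_le _ _).trans ?_
      rw [norm_smul, Real.norm_of_nonneg hγ.le, add_comm, mul_assoc]
      gcongr
      exact hU.norm_gradient_le x
    have hs : r ^ 2 ≤ 2 * (γ * L * ‖x‖) ^ 2 + 2 * ‖w‖ ^ 2 := by
      have : r ^ 2 ≤ (γ * L * ‖x‖ + ‖w‖) ^ 2 := by gcongr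
      linarith [add_sq_le (a := γ * L * ‖x‖) (b := ‖w‖)]
    have hs4 : r ^ 4 ≤ 8 * (γ * L * ‖x‖) ^ 4 + 8 * ‖w‖ ^ 4 := by
      have : (r ^ 2) ^ 2 ≤ (2 * (γ * L * ‖x‖) ^ 2 + 2 * ‖w‖ ^ 2) ^ 2 := by gcongr
      nlinarith [sq_nonneg ((γ * L * ‖x‖) ^ 2 - ‖w‖ ^ 2)]
    have e1 := mul_le_mul_of_nonneg_left hs hB
    have e2 := mul_le_mul_of_nonneg_left hs4 hC
    linarith
  · congr 1
    ring

/-- The Lipschitz gradient produces a mixed term `‖x‖ * ‖y - x‖`. Young's inequality with weight `τ`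
splits it: a small `τ` controls the `‖x‖²` part, while the rest gains another factor `γ` on
integration. -/
theorem RegularPotential.one_sub_acceptance_le (hU : RegularPotential U L) {γ τ : ℝ} (hγ : 0 < γ)
    (hτ : 0 < τ) (x y : E d) :
    1 - acceptance U γ x y ≤ |trapezoidError U x y| +
      γ * (L ^ 2 / 4) * (τ * ‖x‖ ^ 2 + (1 + 1 / τ) * ‖y - x‖ ^ 2) := by
  refine (MALA.one_sub_acceptance_le U hγ x y).trans (add_le_add le_rfl ?_)
  have hL := hU.nonneg
  have h1 : |‖gradient U x‖ - ‖gradient U y‖| ≤ L * ‖y - x‖ := by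
    rw [abs_sub_comm]
    exact (abs_norm_sub_norm_le _ _).trans (hU.norm_gradient_sub_le x y)
  have h2 := hU.norm_gradient_le x
  have h3 : ‖gradient U y‖ ≤ L * ‖x‖ + L * ‖y - x‖ := by
    linarith [(abs_le.1 h1).1]
  have h4 : |‖gradient U x‖ ^ 2 - ‖gradient U y‖ ^ 2| ≤
      L ^ 2 * (2 * ‖x‖ * ‖y - x‖ + ‖y - x‖ ^ 2) := by
    rw [sq_sub_sq, abs_mul, abs_of_nonneg (by positivity)]
    calc (‖gradient U x‖ + ‖gradient U y‖) * |‖gradient U x‖ - ‖gradient U y‖|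
        ≤ (L * ‖x‖ + (L * ‖x‖ + L * ‖y - x‖)) * (L * ‖y - x‖) := by gcongr
      _ = _ := by ring
  have h5 : 2 * ‖x‖ * ‖y - x‖ ≤ τ * ‖x‖ ^ 2 + 1 / τ * ‖y - x‖ ^ 2 := by
    have : τ * ‖x‖ ^ 2 + 1 / τ * ‖y - x‖ ^ 2 - 2 * ‖x‖ * ‖y - x‖ =
        (τ * ‖x‖ - ‖y - x‖) ^ 2 / τ := by field_simp; ring
    have h0 : 0 ≤ (τ * ‖x‖ - ‖y - x‖) ^ 2 / τ := by positivity
    linarith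
  calc γ / 4 * |‖gradient U x‖ ^ 2 - ‖gradient U y‖ ^ 2|
      ≤ γ / 4 * (L ^ 2 * (τ * ‖x‖ ^ 2 + 1 / τ * ‖y - x‖ ^ 2 + ‖y - x‖ ^ 2)) := by
        gcongr
        exact h4.trans (by gcongr)
    _ = _ := by ring

set_option maxHeartbeats 400000 in
/-- The rejection probability is `o(γ)`, uniformly relative to `1 + ‖x‖²`. -/
theorem RegularPotential.exists_rejection_le (hU : RegularPotential U L) {η : ℝ} (hη : 0 < η) :
    ∃ Γ : ℝ, 0 < Γ ∧ Γ ≤ 1 ∧ ∀ γ : ℝ, 0 < γ → γ ≤ Γ → ∀ x : E d,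
      rejection U γ x ≤ ENNReal.ofReal (η * γ * (1 + ‖x‖ ^ 2)) := by
  have hL := hU.nonneg
  set D : ℝ := 2 ^ ((d : ℝ) / 2) with hD
  have hD0 : 0 < D := by positivity
  -- `γ * P * (1 + ‖x‖²)` will bound the mean of `‖y - x‖²`; `τ` makes the Young term cost at most
  -- `η / 4`.
  set P : ℝ := 2 * L ^ 2 + 2 * (8 * D) with hP
  have hP0 : 0 < P := by positivity
  set τ : ℝ := η / (L ^ 2 + 1) with hτ
  have hτ0 : 0 < τ := by positivity
  have hτL : L ^ 2 / 4 * τ ≤ η / 4 := by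
    rw [hτ, div_mul_div_comm, div_le_div_iff₀ (by positivity) (by norm_num)]
    nlinarith
  -- Beyond radius `M`, the noise part of the crude trapezoidal bound is at most `γ * (η / 4) *
  -- ‖x‖²`.
  set M : ℝ := 1 + 16 * L * (8 * D) / η with hM
  have hM1 : 1 ≤ M := by rw [hM]; exact le_add_of_nonneg_right (by positivity)
  have hM2 : 4 * L * (8 * D) ≤ η / 4 * M ^ 2 := by
    have h1 : 16 * L * (8 * D) = η * (M - 1) := by rw [hM]; field_simp; ring
    have h2 : η * (M - 1) ≤ η * M ^ 2 := by
      gcongr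
      linarith [le_self_pow₀ hM1 two_ne_zero]
    linarith
  obtain ⟨C, hC0, hC⟩ := hU.exists_abs_trapezoidError_le M (δ := η / (4 * P)) (by positivity)
  set s₁ : ℝ := L ^ 2 / 4 * (1 + 1 / τ) with hs₁
  have hs₁0 : 0 ≤ s₁ := by positivity
  set s₂ : ℝ := C * (8 * (L * M) ^ 4 + 8 * (128 * D)) with hs₂
  have hs₂0 : 0 ≤ s₂ := by positivity
  set s₃ : ℝ := 4 * L ^ 3 with hs₃
  have hs₃0 : 0 ≤ s₃ := by positivity
  -- `S` collects the coefficients of all contributions of order `γ²`; taking `γ * S ≤ η / 4` makes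
  -- each of them negligible.
  set S : ℝ := s₁ * P + s₂ + s₃ with hS
  have hS0 : 0 ≤ S := by positivity
  refine ⟨min 1 (η / (4 * (S + 1))), by positivity, min_le_left _ _, fun γ hγ hγΓ x => ?_⟩
  have hγ1 : γ ≤ 1 := hγΓ.trans (min_le_left _ _)
  have hγS : γ * S ≤ η / 4 := by
    have := (le_div_iff₀ (by positivity)).1 (hγΓ.trans (min_le_right _ _))
    nlinarith
  have hP1 : γ * (s₁ * P) ≤ η / 4 := le_trans (by gcongr; rw [hS]; linarith) hγS
  have hP2 : γ * s₂ ≤ η / 4 :=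
    le_trans (by gcongr; rw [hS]; linarith [mul_nonneg hs₁0 hP0.le]) hγS
  have hP3 : γ * s₃ ≤ η / 4 :=
    le_trans (by gcongr; rw [hS]; linarith [mul_nonneg hs₁0 hP0.le]) hγS
  have hx0 : 0 ≤ ‖x‖ ^ 2 := by positivity
  have hγγ : γ ^ 2 ≤ γ := pow_le_of_le_one hγ.le hγ1 two_ne_zero
  have hH : 2 * (γ * L * ‖x‖) ^ 2 + 2 * (8 * D * γ) ≤ γ * P * (1 + ‖x‖ ^ 2) := by
    have : γ ^ 2 * (2 * L ^ 2 * ‖x‖ ^ 2) ≤ γ * (2 * L ^ 2 * ‖x‖ ^ 2) := by gcongr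
    have h1 : 0 ≤ γ * (2 * L ^ 2) := by positivity
    have h2 : 0 ≤ γ * (2 * (8 * D)) * ‖x‖ ^ 2 := by positivity
    rw [hP]
    linarith
  have hA : γ * (L ^ 2 / 4 * τ) * ‖x‖ ^ 2 ≤ γ * (η / 4) * (1 + ‖x‖ ^ 2) := by
    gcongr
    linarith
  have hG : γ * s₁ * (2 * (γ * L * ‖x‖) ^ 2 + 2 * (8 * D * γ)) ≤
      γ * (η / 4) * (1 + ‖x‖ ^ 2) := by
    calc γ * s₁ * (2 * (γ * L * ‖x‖) ^ 2 + 2 * (8 * D * γ))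
        ≤ γ * s₁ * (γ * P * (1 + ‖x‖ ^ 2)) := by gcongr
      _ = γ * (γ * (s₁ * P)) * (1 + ‖x‖ ^ 2) := by ring
      _ ≤ _ := by gcongr
  rcases le_total ‖x‖ M with hx | hx
  · refine (hU.rejection_le_of_forall hγ (A := γ * (L ^ 2 / 4 * τ) * ‖x‖ ^ 2)
      (B := η / (4 * P) + γ * s₁) (C := C) (by positivity) (by positivity) hC0 x
      fun y => ?_).trans (ENNReal.ofReal_le_ofReal ?_)
    · refine (hU.one_sub_acceptance_le hγ hτ0 x y).trans ?_
      refine (add_le_add_left (hC x y hx) _).trans (le_of_eq ?_)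
      rw [hs₁]
      ring
    · have h1 : η / (4 * P) * (2 * (γ * L * ‖x‖) ^ 2 + 2 * (8 * D * γ)) ≤
          γ * (η / 4) * (1 + ‖x‖ ^ 2) := by
        refine (mul_le_mul_of_nonneg_left hH (by positivity)).trans (le_of_eq ?_)
        field_simp
      have h2 : C * (8 * (γ * L * ‖x‖) ^ 4 + 8 * (128 * D * γ ^ 2)) ≤
          γ * (η / 4) * (1 + ‖x‖ ^ 2) := by
        have e1 : (γ * L * ‖x‖) ^ 4 ≤ γ ^ 2 * (L * M) ^ 4 := by
          rw [mul_assoc, mul_pow]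
          have : γ ^ 4 ≤ γ ^ 2 := pow_le_pow_of_le_one hγ.le hγ1 (by norm_num)
          gcongr
        calc C * (8 * (γ * L * ‖x‖) ^ 4 + 8 * (128 * D * γ ^ 2))
            ≤ C * (8 * (γ ^ 2 * (L * M) ^ 4) + 8 * (128 * D * γ ^ 2)) := by gcongr
          _ = γ * (γ * s₂) * 1 := by rw [hs₂]; ring
          _ ≤ _ := by gcongr; linarith
      rw [add_mul]
      linarith
  · refine (hU.rejection_le_of_forall hγ (A := γ * (L ^ 2 / 4 * τ) * ‖x‖ ^ 2)
      (B := 2 * L + γ * s₁) (C := 0) (by positivity) (by positivity) le_rfl x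
      fun y => ?_).trans (ENNReal.ofReal_le_ofReal ?_)
    · refine (hU.one_sub_acceptance_le hγ hτ0 x y).trans ?_
      refine (add_le_add_left (hU.abs_trapezoidError_le x y) _).trans (le_of_eq ?_)
      rw [hs₁]
      ring
    · have h1 : 2 * L * (2 * (γ * L * ‖x‖) ^ 2 + 2 * (8 * D * γ)) ≤
          γ * (η / 2) * (1 + ‖x‖ ^ 2) := by
        have e1 : M ^ 2 ≤ ‖x‖ ^ 2 := by gcongr
        calc 2 * L * (2 * (γ * L * ‖x‖) ^ 2 + 2 * (8 * D * γ))
            = γ * ((γ * s₃) * ‖x‖ ^ 2 + 4 * L * (8 * D)) := by rw [hs₃]; ring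
          _ ≤ γ * (η / 4 * ‖x‖ ^ 2 + η / 4 * M ^ 2) := by gcongr
          _ ≤ γ * (η / 4 * (1 + ‖x‖ ^ 2) + η / 4 * (1 + ‖x‖ ^ 2)) := by gcongr <;> linarith
          _ = _ := by ring
      rw [add_mul, zero_mul, add_zero]
      have : 0 ≤ γ * η * (1 + ‖x‖ ^ 2) := by positivity
      linarith

/-! ### The unadjusted transition operator -/

theorem measurable_ofReal_proposalDensity (hU : ContDiff ℝ 2 U) (γ : ℝ) (x : E d) :
    Measurable fun y => ENNReal.ofReal (proposalDensity U γ x y) :=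
  ((measurable_proposalDensity hU γ).comp measurable_prodMk_left).ennreal_ofReal

theorem measurable_ulaOp (hU : ContDiff ℝ 2 U) (γ : ℝ) {F : E d → ℝ≥0∞} (hF : Measurable F) :
    Measurable (ulaOp U γ F) :=
  ((hF.comp measurable_snd).mul
    (measurable_proposalDensity hU γ).ennreal_ofReal).lintegral_prod_right'

theorem measurable_ulaOp_iterate (hU : ContDiff ℝ 2 U) (γ : ℝ) {F : E d → ℝ≥0∞}
    (hF : Measurable F) (n : ℕ) : Measurable ((ulaOp U γ)^[n] F) := by
  induction n with
  | zero => exact hF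
  | succ n ih => rw [Function.iterate_succ_apply']; exact measurable_ulaOp hU γ ih

theorem ulaOp_mono (U : E d → ℝ) (γ : ℝ) {F G : E d → ℝ≥0∞} (h : ∀ x, F x ≤ G x) (x : E d) :
    ulaOp U γ F x ≤ ulaOp U γ G x :=
  lintegral_mono fun y => mul_le_mul_left (h y) _

theorem ulaOp_add (hU : ContDiff ℝ 2 U) (γ : ℝ) {F : E d → ℝ≥0∞} (hF : Measurable F)
    (G : E d → ℝ≥0∞) (x : E d) :
    ulaOp U γ (fun y => F y + G y) x = ulaOp U γ F x + ulaOp U γ G x := by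
  simp only [ulaOp, add_mul]
  exact lintegral_add_left (hF.mul (measurable_ofReal_proposalDensity hU γ x)) _

theorem ulaOp_const_mul (U : E d → ℝ) (γ : ℝ) {c : ℝ≥0∞} (hc : c ≠ ∞) (F : E d → ℝ≥0∞)
    (x : E d) : ulaOp U γ (fun y => c * F y) x = c * ulaOp U γ F x := by
  simp only [ulaOp, mul_assoc]
  exact lintegral_const_mul' _ _ hc

theorem lintegral_proposalDensity_eq_one (U : E d → ℝ) {γ : ℝ} (hγ : 0 < γ) (x : E d) :
    ∫⁻ y, ENNReal.ofReal (proposalDensity U γ x y) = 1 := by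
  simpa [lintegral_heat hγ] using lintegral_proposalDensity U γ x 1

/-- Growth of second moments under one step of the unadjusted Langevin algorithm. -/
theorem RegularPotential.ulaOp_one_add_sq_le (hU : RegularPotential U L) {γ : ℝ} (hγ : 0 < γ)
    (hγ1 : γ ≤ 1) (x : E d) :
    ulaOp U γ (fun y => ENNReal.ofReal (1 + ‖y‖ ^ 2)) x ≤
      ENNReal.ofReal (1 + (2 * L + L ^ 2 + 8 * 2 ^ ((d : ℝ) / 2)) * γ) *
        ENNReal.ofReal (1 + ‖x‖ ^ 2) := by
  have hL := hU.nonneg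
  set D : ℝ := 8 * 2 ^ ((d : ℝ) / 2) with hD
  have hD0 : 0 < D := by positivity
  set T := drift U γ x with hT
  have h1 : ulaOp U γ (fun y => ENNReal.ofReal (1 + ‖y‖ ^ 2)) x =
      ∫⁻ w, ENNReal.ofReal (1 + ‖T + w‖ ^ 2) * ENNReal.ofReal (heat γ w) :=
    lintegral_proposalDensity U γ x _
  -- Averaging over `w` and `-w` removes the cross term between `T` and the noise, which would
  -- otherwise contribute at order `√γ` instead of `γ`.
  have h2 : ulaOp U γ (fun y => ENNReal.ofReal (1 + ‖y‖ ^ 2)) x =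
      ∫⁻ w, ENNReal.ofReal (1 + ‖T - w‖ ^ 2) * ENNReal.ofReal (heat γ w) := by
    rw [h1, ← lintegral_neg_eq_self]
    simp only [heat_neg, sub_eq_add_neg]
  have h3 : 2 * ulaOp U γ (fun y => ENNReal.ofReal (1 + ‖y‖ ^ 2)) x ≤
      2 * ENNReal.ofReal (1 + ‖T‖ ^ 2 + D * γ) := by
    have hm : Measurable fun w => ENNReal.ofReal (1 + ‖T + w‖ ^ 2) * ENNReal.ofReal (heat γ w) :=
      (by fun_prop : Measurable fun w => 1 + ‖T + w‖ ^ 2).ennreal_ofReal.mul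
        (measurable_ofReal_heat γ)
    rw [two_mul]
    nth_rewrite 1 [h1]
    rw [h2, ← lintegral_add_left hm]
    have hq := lintegral_quartic_mul_heat_le (d := d) hγ
      (show 0 ≤ 2 * (1 + ‖T‖ ^ 2) by positivity) (show (0 : ℝ) ≤ 2 by norm_num) le_rfl
    calc _ = ∫⁻ w : E d, ENNReal.ofReal
          ((2 * (1 + ‖T‖ ^ 2) + 2 * ‖w‖ ^ 2 + 0 * ‖w‖ ^ 4) * heat γ w) := by
          refine lintegral_congr fun w => ?_
          have := parallelogram_law_with_norm ℝ T w
          rw [← add_mul, ← ENNReal.ofReal_add (by positivity) (by positivity),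
            ← ENNReal.ofReal_mul (by positivity)]
          congr 2
          linarith
      _ ≤ _ := hq
      _ = 2 * ENNReal.ofReal (1 + ‖T‖ ^ 2 + D * γ) := by
          rw [show 2 * (1 + ‖T‖ ^ 2) + 2 * (8 * 2 ^ ((d : ℝ) / 2) * γ) +
            0 * (128 * 2 ^ ((d : ℝ) / 2) * γ ^ 2) = 2 * (1 + ‖T‖ ^ 2 + D * γ) by rw [hD]; ring,
            ENNReal.ofReal_mul zero_le_two, ENNReal.ofReal_ofNat]
  have h4 := (ENNReal.mul_le_mul_iff_right two_ne_zero ENNReal.ofNat_ne_top).1 h3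
  refine h4.trans ?_
  rw [← ENNReal.ofReal_mul (by positivity)]
  refine ENNReal.ofReal_le_ofReal ?_
  have h5 : ‖T‖ ^ 2 ≤ (1 + γ * L) ^ 2 * ‖x‖ ^ 2 := by
    rw [← mul_pow]
    gcongr
    exact hU.norm_drift_le hγ.le x
  have h6 : γ ^ 2 * (L ^ 2 * ‖x‖ ^ 2) ≤ γ * (L ^ 2 * ‖x‖ ^ 2) := by
    gcongr
    nlinarith
  have h7 : 0 ≤ (2 * L + L ^ 2) * γ := by positivity
  have h8 : 0 ≤ D * γ * ‖x‖ ^ 2 := by positivity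
  linarith

/-! ### Comparison of MALA with the unadjusted chain -/

theorem measurable_acceptance_mul (hU : ContDiff ℝ 2 U) (γ : ℝ) (x : E d) : Measurable fun y =>
    ENNReal.ofReal (acceptance U γ x y * proposalDensity U γ x y) :=
  (((measurable_acceptance hU γ).mul (measurable_proposalDensity hU γ)).comp
    measurable_prodMk_left).ennreal_ofReal

theorem lintegral_malaKernel (hU : ContDiff ℝ 2 U) (γ : ℝ) (x : E d) {F : E d → ℝ≥0∞}
    (hF : Measurable F) :
    ∫⁻ y, F y ∂(malaKernel U hU γ x) =
      (∫⁻ y, ENNReal.ofReal (acceptance U γ x y * proposalDensity U γ x y) * F y) +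
        rejection U γ x * F x := by
  change ∫⁻ y, F y ∂(stepLaw U γ x) = _
  rw [stepLaw, lintegral_add_measure, lintegral_smul_measure, lintegral_dirac' _ hF,
    lintegral_withDensity_eq_lintegral_mul _ (measurable_acceptance_mul hU γ x) hF]
  rfl

theorem ofReal_acceptance_add (U : E d → ℝ) {γ : ℝ} (hγ : 0 < γ) (x y : E d) :
    ENNReal.ofReal (acceptance U γ x y * proposalDensity U γ x y) +
      ENNReal.ofReal ((1 - acceptance U γ x y) * proposalDensity U γ x y) =
      ENNReal.ofReal (proposalDensity U γ x y) := by
  have h0 : 0 ≤ proposalDensity U γ x y := by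
    rw [proposalDensity_eq_heat]; exact (heat_pos hγ _).le
  rw [← ENNReal.ofReal_add (mul_nonneg (acceptance_nonneg U hγ x y) h0)
    (mul_nonneg (sub_nonneg.2 (acceptance_le_one U γ x y)) h0)]
  congr 1
  ring

theorem isMarkovKernel_malaKernel (hU : ContDiff ℝ 2 U) {γ : ℝ} (hγ : 0 < γ) :
    IsMarkovKernel (malaKernel U hU γ) := by
  refine ⟨fun x => ⟨?_⟩⟩
  have := lintegral_malaKernel hU γ x (F := fun _ => 1) measurable_const
  rw [lintegral_one] at this
  simp only [this, mul_one]
  rw [rejection, ← lintegral_add_left (measurable_acceptance_mul hU γ x)]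
  simp only [ofReal_acceptance_add U hγ, lintegral_proposalDensity_eq_one U hγ]

theorem isMarkovKernel_pow {X : Type*} [MeasurableSpace X] (κ : Kernel X X) [IsMarkovKernel κ]
    (n : ℕ) : IsMarkovKernel (κ ^ n) := by
  induction n with
  | zero => exact inferInstanceAs (IsMarkovKernel Kernel.id)
  | succ n ih =>
    rw [pow_succ]
    exact inferInstanceAs (IsMarkovKernel ((κ ^ n) ∘ₖ κ))

/-- The two kernels share their accepted moves; on rejected proposals the test function is at most
1. -/
theorem ulaOp_le_lintegral_malaKernel (hU : ContDiff ℝ 2 U) {γ : ℝ} (hγ : 0 < γ) (x : E d)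
    {F : E d → ℝ≥0∞} (hF : Measurable F) (hF1 : ∀ y, F y ≤ 1) :
    ulaOp U γ F x ≤ ∫⁻ y, F y ∂(malaKernel U hU γ x) + rejection U γ x := by
  rw [lintegral_malaKernel hU γ x hF]
  calc ulaOp U γ F x
      ≤ ∫⁻ y, (ENNReal.ofReal (acceptance U γ x y * proposalDensity U γ x y) * F y +
          ENNReal.ofReal ((1 - acceptance U γ x y) * proposalDensity U γ x y)) := by
        refine lintegral_mono fun y => ?_
        rw [← ofReal_acceptance_add U hγ, mul_comm, add_mul]
        gcongr
        exact mul_le_of_le_one_right' (hF1 y)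
    _ = (∫⁻ y, ENNReal.ofReal (acceptance U γ x y * proposalDensity U γ x y) * F y) +
          rejection U γ x := lintegral_add_left ((measurable_acceptance_mul hU γ x).mul hF) _
    _ ≤ _ := by gcongr; exact le_self_add

/-- Comparison of `n` steps of the unadjusted algorithm with `n` steps of MALA. -/
theorem RegularPotential.ulaOp_iterate_le (hU : RegularPotential U L) {γ η : ℝ} (hγ : 0 < γ)
    (hγ1 : γ ≤ 1) (hη : 0 ≤ η)
    (hrej : ∀ x, rejection U γ x ≤ ENNReal.ofReal (η * γ * (1 + ‖x‖ ^ 2)))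
    {F : E d → ℝ≥0∞} (hF : Measurable F) (hF1 : ∀ y, F y ≤ 1) (n : ℕ) (x : E d) :
    (ulaOp U γ)^[n] F x ≤ ∫⁻ y, F y ∂((malaKernel U hU.contDiff γ ^ n) x) +
      ENNReal.ofReal (n * (η * γ) *
        (1 + (2 * L + L ^ 2 + 8 * 2 ^ ((d : ℝ) / 2)) * γ) ^ n) *
        ENNReal.ofReal (1 + ‖x‖ ^ 2) := by
  have hL := hU.nonneg
  set q : ℝ := 1 + (2 * L + L ^ 2 + 8 * 2 ^ ((d : ℝ) / 2)) * γ with hq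
  have hq1 : 1 ≤ q := by rw [hq]; exact le_add_of_nonneg_right (by positivity)
  have hq0 : 0 ≤ q := zero_le_one.trans hq1
  have := isMarkovKernel_malaKernel hU.contDiff hγ
  induction n generalizing x with
  | zero =>
    have : (malaKernel U hU.contDiff γ ^ 0) x = Measure.dirac x := by
      rw [pow_zero]; exact Kernel.id_apply x
    rw [this, lintegral_dirac' _ hF]
    exact le_self_add
  | succ n ih =>
    have hMn := isMarkovKernel_pow (malaKernel U hU.contDiff γ) n
    set R : E d → ℝ≥0∞ := fun z => ∫⁻ y, F y ∂((malaKernel U hU.contDiff γ ^ n) z) with hR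
    have hRm : Measurable R := hF.lintegral_kernel
    have hR1 : ∀ z, R z ≤ 1 := fun z => by
      refine (lintegral_mono hF1).trans ?_
      rw [lintegral_one, measure_univ]
    have hsucc : ∫⁻ y, F y ∂((malaKernel U hU.contDiff γ ^ (n + 1)) x) =
        ∫⁻ z, R z ∂(malaKernel U hU.contDiff γ x) := by
      rw [pow_succ]
      exact Kernel.lintegral_comp _ _ x hF
    rw [Function.iterate_succ_apply', hsucc]
    refine (ulaOp_mono U γ ih x).trans ?_
    rw [ulaOp_add hU.contDiff γ hRm, ulaOp_const_mul _ _ ENNReal.ofReal_ne_top]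
    calc _ ≤ (∫⁻ z, R z ∂(malaKernel U hU.contDiff γ x) +
            ENNReal.ofReal (η * γ) * ENNReal.ofReal (1 + ‖x‖ ^ 2)) +
          ENNReal.ofReal (n * (η * γ) * q ^ n) *
            (ENNReal.ofReal q * ENNReal.ofReal (1 + ‖x‖ ^ 2)) := by
          -- The first of the `n + 1` steps adds a fresh rejection error; the error of the later `n`
          -- steps is averaged over the first move, which multiplies it by at most `q`.
          refine add_le_add ((ulaOp_le_lintegral_malaKernel hU.contDiff hγ x hRm hR1).trans ?_)
            (mul_le_mul_right (hU.ulaOp_one_add_sq_le hγ hγ1 x) _)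
          rw [← ENNReal.ofReal_mul (by positivity)]
          gcongr
          exact hrej x
      _ ≤ _ := by
          rw [add_assoc, ← mul_assoc, ← ENNReal.ofReal_mul (q := q) (by positivity), ← add_mul,
            ← ENNReal.ofReal_add (by positivity) (by positivity)]
          gcongr
          have : η * γ * 1 ≤ η * γ * q ^ (n + 1) := by
            gcongr
            exact one_le_pow₀ hq1
          push_cast
          rw [pow_succ] at this ⊢
          linarith

/-! ### Overlap of the unadjusted chains by Hellinger affinity -/

/-- The Cauchy-Schwarz inequality for lower integrals. -/
theorem lintegral_sqrt_mul_sqrt_le {X : Type*} [MeasurableSpace X] (μ : Measure X)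
    {f g : X → ℝ≥0∞} (hf : AEMeasurable f μ) (hg : AEMeasurable g μ) :
    ∫⁻ x, f x ^ (1 / 2 : ℝ) * g x ^ (1 / 2 : ℝ) ∂μ ≤
      (∫⁻ x, f x ∂μ) ^ (1 / 2 : ℝ) * (∫⁻ x, g x ∂μ) ^ (1 / 2 : ℝ) :=
  ENNReal.lintegral_mul_norm_pow_le hf hg (by norm_num) (by norm_num) (by norm_num)

/-- The geometric mean of two Gaussian densities with the same covariance. -/
theorem sqrt_heat_mul_sqrt_heat {γ : ℝ} (hγ : 0 < γ) (a b z : E d) :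
    ENNReal.ofReal (heat γ (z - a)) ^ (1 / 2 : ℝ) * ENNReal.ofReal (heat γ (z - b)) ^ (1 / 2 : ℝ) =
      ENNReal.ofReal (Real.exp (-‖b - a‖ ^ 2 / (16 * γ))) *
        ENNReal.ofReal (heat γ (z - (1 / 2 : ℝ) • (a + b))) := by
  have h1 := heat_pos hγ (z - (1 / 2 : ℝ) • (a + b))
  have key : heat γ (z - a) * heat γ (z - b) =
      (Real.exp (-‖b - a‖ ^ 2 / (16 * γ)) * heat γ (z - (1 / 2 : ℝ) • (a + b))) ^ 2 := by
    -- The parallelogram law about the midpoint of `a` and `b` separates the dependence on `z` from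
    -- `‖b - a‖²`.
    have hpar := parallelogram_law_with_norm ℝ (z - (1 / 2 : ℝ) • (a + b)) ((1 / 2 : ℝ) • (b - a))
    have e1 : z - (1 / 2 : ℝ) • (a + b) + (1 / 2 : ℝ) • (b - a) = z - a := by module
    have e2 : z - (1 / 2 : ℝ) • (a + b) - (1 / 2 : ℝ) • (b - a) = z - b := by module
    rw [e1, e2, norm_smul, Real.norm_of_nonneg (by norm_num)] at hpar
    unfold heat
    rw [mul_mul_mul_comm, ← Real.exp_add, mul_left_comm, ← Real.exp_add, mul_pow,
      ← Real.exp_nat_mul, ← sq]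
    congr 2
    field_simp
    push_cast
    linarith
  rw [← ENNReal.mul_rpow_of_nonneg _ _ (by norm_num), ← ENNReal.ofReal_mul (heat_pos hγ _).le, key,
    ← ENNReal.ofReal_mul (Real.exp_pos _).le, ENNReal.ofReal_rpow_of_nonneg (by positivity)
    (by norm_num), ← Real.sqrt_eq_rpow, Real.sqrt_sq (by positivity)]

/-- Propagation of a lower bound on the Hellinger affinity through one step of the unadjusted
Langevin algorithm. -/
theorem overlap_ulaOp (U : E d → ℝ) {γ : ℝ} (hγ : 0 < γ) {F G : E d → ℝ≥0∞}
    (hF : Measurable F) (hG : Measurable G) (x y v : E d) {c : ℝ≥0∞}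
    (h : ∀ z, c ≤ F z ^ (1 / 2 : ℝ) + G (z + v) ^ (1 / 2 : ℝ)) :
    c * ENNReal.ofReal (Real.exp (-‖drift U γ y - v - drift U γ x‖ ^ 2 / (16 * γ))) ≤
      ulaOp U γ F x ^ (1 / 2 : ℝ) + ulaOp U γ G y ^ (1 / 2 : ℝ) := by
  set a := drift U γ x with ha
  set b := drift U γ y - v with hb
  set p : E d → ℝ≥0∞ := fun z => ENNReal.ofReal (heat γ (z - a)) with hp
  set q : E d → ℝ≥0∞ := fun z => ENNReal.ofReal (heat γ (z - b)) with hq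
  have hpm : Measurable p := (measurable_ofReal_heat γ).comp (measurable_id.sub_const a)
  have hqm : Measurable q := (measurable_ofReal_heat γ).comp (measurable_id.sub_const b)
  have hGv : Measurable fun z => G (z + v) := hG.comp (measurable_id.add_const v)
  have hFx : ulaOp U γ F x = ∫⁻ z, F z * p z := by
    simp only [ulaOp, proposalDensity_eq_heat, hp, ha]
  have hGy : ulaOp U γ G y = ∫⁻ z, G (z + v) * q z := by
    simp only [ulaOp, proposalDensity_eq_heat, hq, hb]
    rw [← lintegral_add_right_eq_self _ v]
    simp only [sub_sub_eq_add_sub]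
  have hp1 : ∫⁻ z, p z = 1 := by
    rw [hp, lintegral_sub_right_eq_self (fun z => ENNReal.ofReal (heat γ z)), lintegral_heat hγ]
  have hq1 : ∫⁻ z, q z = 1 := by
    rw [hq, lintegral_sub_right_eq_self (fun z => ENNReal.ofReal (heat γ z)), lintegral_heat hγ]
  have hpq : ∫⁻ z, p z ^ (1 / 2 : ℝ) * q z ^ (1 / 2 : ℝ) =
      ENNReal.ofReal (Real.exp (-‖b - a‖ ^ 2 / (16 * γ))) := by
    simp only [hp, hq, sqrt_heat_mul_sqrt_heat hγ]
    rw [lintegral_const_mul' _ _ ENNReal.ofReal_ne_top,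
      lintegral_sub_right_eq_self (fun z => ENNReal.ofReal (heat γ z)), lintegral_heat hγ, mul_one]
  -- Each test function is integrated against its own Gaussian and paired with the other one, so
  -- both left-hand sides carry the common factor `√p * √q`.
  have hcs1 := lintegral_sqrt_mul_sqrt_le volume (hF.mul hpm).aemeasurable hqm.aemeasurable
  have hcs2 := lintegral_sqrt_mul_sqrt_le volume (hGv.mul hqm).aemeasurable hpm.aemeasurable
  simp only [Pi.mul_apply] at hcs1 hcs2
  rw [hq1, ENNReal.one_rpow, mul_one, ← hFx] at hcs1
  rw [hp1, ENNReal.one_rpow, mul_one, ← hGy] at hcs2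
  refine le_trans ?_ (add_le_add hcs1 hcs2)
  have hm : Measurable fun z => (F z * p z) ^ (1 / 2 : ℝ) * q z ^ (1 / 2 : ℝ) :=
    ((hF.mul hpm).pow_const _).mul (hqm.pow_const _)
  have hm' : Measurable fun z => p z ^ (1 / 2 : ℝ) * q z ^ (1 / 2 : ℝ) :=
    (hpm.pow_const _).mul (hqm.pow_const _)
  rw [← lintegral_add_left hm, ← hpq, ← lintegral_const_mul _ hm']
  refine lintegral_mono fun z => ?_
  simp only [ENNReal.mul_rpow_of_nonneg _ _ (show (0 : ℝ) ≤ 1 / 2 by norm_num)]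
  calc c * (p z ^ (1 / 2 : ℝ) * q z ^ (1 / 2 : ℝ))
      ≤ (F z ^ (1 / 2 : ℝ) + G (z + v) ^ (1 / 2 : ℝ)) * (p z ^ (1 / 2 : ℝ) * q z ^ (1 / 2 : ℝ)) := by
        gcongr
        exact h z
    _ = _ := by ring

/-- Lower bound for the Hellinger affinity of the laws of the unadjusted Langevin algorithm
started from two points. -/
theorem RegularPotential.overlap_ulaOp_iterate (hU : RegularPotential U L) {γ : ℝ} (hγ : 0 < γ)
    {F G : E d → ℝ≥0∞} (hF : Measurable F) (hG : Measurable G) (hFG : ∀ z, 1 ≤ F z + G z)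
    (n : ℕ) (x y : E d) :
    ENNReal.ofReal (Real.exp (-((1 + (2 * L + γ * L ^ 2) * (γ * (n + 1))) / (16 * (γ * (n + 1))) *
      ‖y - x‖ ^ 2))) ≤
      (ulaOp U γ)^[n + 1] F x ^ (1 / 2 : ℝ) + (ulaOp U γ)^[n + 1] G y ^ (1 / 2 : ℝ) := by
  have hL := hU.nonneg
  set l : ℝ := 2 * L + γ * L ^ 2 with hl
  have hl0 : 0 ≤ l := by positivity
  have hdrift : ∀ x y, ‖drift U γ y - drift U γ x‖ ^ 2 ≤ (1 + l * γ) * ‖y - x‖ ^ 2 := fun x y => by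
    have : ‖drift U γ y - drift U γ x‖ ^ 2 ≤ ((1 + γ * L) * ‖y - x‖) ^ 2 := by
      gcongr
      exact hU.norm_drift_sub_le hγ.le x y
    rw [hl]
    linarith
  induction n generalizing x y with
  | zero =>
    have h := overlap_ulaOp U hγ hF hG x y 0 (c := 1) fun z => by
      rw [add_zero]
      refine le_trans ?_ (ENNReal.rpow_add_le_add_rpow (F z) (G z) (by norm_num) (by norm_num))
      exact ENNReal.one_le_rpow (hFG z) (by norm_num)
    refine le_trans ?_ h
    rw [one_mul, sub_zero]
    refine ENNReal.ofReal_le_ofReal (Real.exp_le_exp.2 ?_)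
    rw [neg_div, neg_le_neg_iff, Nat.cast_zero, zero_add, mul_one, div_mul_eq_mul_div]
    gcongr
    exact hdrift x y
  | succ n ih =>
    set s : ℝ := γ * (n + 1) with hs
    have hs0 : 0 < s := by positivity
    have hsucc : γ * ((n + 1 : ℕ) + 1) = s + γ := by push_cast; rw [hs]; ring
    -- A fraction `k` of the gap `u` is left to the remaining steps and `1 - k` is paid for now.
    -- This `k` minimizes `(1 + l * s) / (16 * s) * k ^ 2 + (1 - k) ^ 2 / (16 * γ)`; `e1` evaluates
    -- the minimum.
    set k : ℝ := s / (s + γ * (1 + l * s)) with hk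
    set u := drift U γ y - drift U γ x with hu
    have hvu : drift U γ y - k • u - drift U γ x = (1 - k) • u := by rw [hu]; module
    have h := overlap_ulaOp U hγ (measurable_ulaOp_iterate hU.contDiff γ hF (n + 1))
      (measurable_ulaOp_iterate hU.contDiff γ hG (n + 1)) x y (k • u) fun z => by
        have := ih z (z + k • u)
        rwa [add_sub_cancel_left] at this
    rw [Function.iterate_succ_apply', Function.iterate_succ_apply' _ _ G]
    refine le_trans ?_ h
    rw [← ENNReal.ofReal_mul (Real.exp_pos _).le, ← Real.exp_add, hvu, norm_smul, norm_smul,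
      hsucc, mul_pow, mul_pow, Real.norm_eq_abs, Real.norm_eq_abs, sq_abs, sq_abs]
    refine ENNReal.ofReal_le_ofReal (Real.exp_le_exp.2 ?_)
    have e1 : (1 + l * s) / (16 * s) * (k ^ 2 * ‖u‖ ^ 2) + (1 - k) ^ 2 * ‖u‖ ^ 2 / (16 * γ) =
        (1 + l * s) / (16 * (s + γ * (1 + l * s))) * ‖u‖ ^ 2 := by
      rw [hk]
      field_simp
      ring
    -- The recursion closes: after cross-multiplication the two sides differ by a positive multiple
    -- of `γ * l * s`.
    have e2 : (1 + l * s) / (16 * (s + γ * (1 + l * s))) * (1 + l * γ) ≤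
        (1 + l * (s + γ)) / (16 * (s + γ)) := by
      rw [div_mul_eq_mul_div, div_le_div_iff₀ (by positivity) (by positivity)]
      have : 0 ≤ γ * l * s := by positivity
      linarith
    have e3 : (1 + l * s) / (16 * (s + γ * (1 + l * s))) * ‖u‖ ^ 2 ≤
        (1 + l * (s + γ)) / (16 * (s + γ)) * ‖y - x‖ ^ 2 := by
      calc _ ≤ (1 + l * s) / (16 * (s + γ * (1 + l * s))) * ((1 + l * γ) * ‖y - x‖ ^ 2) := by
            gcongr
            exact hdrift x y
        _ ≤ _ := by rw [← mul_assoc]; gcongr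
    rw [neg_div, ← neg_add, neg_le_neg_iff, e1]
    exact e3

/-- At time at least 1 the exponent is at most `(2L + 2) / 16 * (2K)² = (L + 1)K² / 2`. Squaring
with `(√a + √b)² ≤ 2(a + b)` doubles the exponent and costs the factor `1 / 2`. -/
theorem RegularPotential.half_exp_le_ulaOp_iterate (hU : RegularPotential U L) {γ K : ℝ}
    (hγ : 0 < γ) (hγL : γ * L ^ 2 ≤ 1) {n : ℕ} (hn : 1 ≤ γ * n) {x y : E d} (hx : ‖x‖ ≤ K)
    (hy : ‖y‖ ≤ K) {F G : E d → ℝ≥0∞} (hF : Measurable F) (hG : Measurable G)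
    (hFG : ∀ z, 1 ≤ F z + G z) :
    ENNReal.ofReal (Real.exp (-((L + 1) * K ^ 2)) / 2) ≤
      (ulaOp U γ)^[n] F x + (ulaOp U γ)^[n] G y := by
  have hL := hU.nonneg
  obtain ⟨n, rfl⟩ : ∃ m, n = m + 1 := Nat.exists_eq_succ_of_ne_zero fun h => by
    rw [h, Nat.cast_zero, mul_zero] at hn
    linarith
  push_cast at hn
  have h := hU.overlap_ulaOp_iterate hγ hF hG hFG n x y
  set a := (ulaOp U γ)^[n + 1] F x
  set b := (ulaOp U γ)^[n + 1] G y
  have hxy : ‖y - x‖ ^ 2 ≤ (2 * K) ^ 2 := by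
    gcongr
    linarith [norm_sub_le y x]
  have h1 : ENNReal.ofReal (Real.exp (-((L + 1) * K ^ 2) / 2)) ≤
      a ^ (1 / 2 : ℝ) + b ^ (1 / 2 : ℝ) := by
    refine le_trans (ENNReal.ofReal_le_ofReal (Real.exp_le_exp.2 ?_)) h
    rw [neg_div, neg_le_neg_iff]
    set s := γ * ((n : ℝ) + 1)
    have hs0 : 0 < s := by linarith
    have e1 : (1 + (2 * L + γ * L ^ 2) * s) / (16 * s) ≤ (2 * L + 2) / 16 := by
      rw [div_le_div_iff₀ (by positivity) (by norm_num)]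
      have : γ * L ^ 2 * s ≤ 1 * s := by gcongr
      linarith
    calc _ ≤ (2 * L + 2) / 16 * (2 * K) ^ 2 := by gcongr
      _ = _ := by ring
  have h2 := ENNReal.rpow_le_rpow h1 (show (0 : ℝ) ≤ 2 by norm_num)
  have h3 := h2.trans (ENNReal.rpow_add_le_mul_rpow_add_rpow (a ^ (1 / 2 : ℝ)) (b ^ (1 / 2 : ℝ))
    (show (1 : ℝ) ≤ 2 by norm_num))
  rw [← ENNReal.rpow_mul, ← ENNReal.rpow_mul, ENNReal.ofReal_rpow_of_pos (Real.exp_pos _),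
    ← Real.exp_mul] at h3
  norm_num at h3
  rw [ENNReal.ofReal_div_of_pos two_pos, ENNReal.ofReal_ofNat]
  refine ENNReal.div_le_of_le_mul' ?_
  exact h3

/-! ### Gaussian tails and total variation -/

theorem gaussianReal_Iic_zero_le : gaussianReal 0 1 (Set.Iic 0) ≤ 2⁻¹ := by
  set μ := gaussianReal 0 1
  have : NullSingletonClass μ := nullSingletonClass_gaussianReal one_ne_zero
  have h1 : μ (Set.Iic 0) = μ (Set.Ioi 0) := by
    have hmap : μ.map (fun x => -x) = μ := by
      simpa using gaussianReal_map_neg (μ := 0) (v := 1)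
    calc μ (Set.Iic 0) = μ.map (fun x => -x) (Set.Iic 0) := by rw [hmap]
      _ = μ (Set.Ici 0) := by
        rw [Measure.map_apply measurable_neg measurableSet_Iic]
        congr 1
        ext x
        simp
      _ = μ (Set.Ioi 0) := (measure_congr Ioi_ae_eq_Ici).symm
  have h2 : μ (Set.Iic 0) + μ (Set.Ioi 0) = 1 := by
    have := prob_add_prob_compl (μ := μ) (measurableSet_Iic (a := (0 : ℝ)))
    rwa [Set.compl_Iic] at this
  rw [← h1, ← mul_two] at h2
  exact (ENNReal.eq_inv_of_mul_eq_one_left h2).le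

/-- Upper bound for the lower tail of the standard Gaussian distribution function. -/
theorem cdf_gaussianReal_neg_le {t : ℝ} (ht : 0 ≤ t) :
    cdf (gaussianReal 0 1) (-t) ≤ Real.exp (-t ^ 2 / 2) / 2 := by
  -- After translation by `t`, the density at `x - t` is the one at `x` times `exp (x * t - t ^ 2 /
  -- 2)`, and `x * t ≤ 0` on the half-line.
  have key : gaussianReal 0 1 (Set.Iic (-t)) ≤
      ENNReal.ofReal (Real.exp (-t ^ 2 / 2)) * gaussianReal 0 1 (Set.Iic 0) := by
    rw [gaussianReal_apply _ one_ne_zero, gaussianReal_apply _ one_ne_zero,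
      ← lintegral_indicator measurableSet_Iic, ← lintegral_indicator measurableSet_Iic,
      ← lintegral_const_mul' _ _ ENNReal.ofReal_ne_top,
      ← lintegral_sub_right_eq_self _ t]
    refine lintegral_mono fun x => ?_
    by_cases hx : x ≤ 0
    · rw [Set.indicator_of_mem (by simpa using hx), Set.indicator_of_mem (by simpa using hx)]
      simp only [gaussianPDF, gaussianPDFReal]
      rw [← ENNReal.ofReal_mul (Real.exp_pos _).le, mul_left_comm, ← Real.exp_add]
      refine ENNReal.ofReal_le_ofReal ?_
      gcongr
      simp only [NNReal.coe_one]
      have : x * t ≤ 0 := mul_nonpos_of_nonpos_of_nonneg hx ht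
      linarith
    · rw [Set.indicator_of_notMem (by simpa using hx)]
      exact zero_le
  rw [cdf_eq_real]
  refine ENNReal.toReal_le_of_le_ofReal (by positivity) (key.trans ?_)
  rw [ENNReal.ofReal_div_of_pos two_pos, ENNReal.ofReal_ofNat]
  exact mul_le_mul_right gaussianReal_Iic_zero_le _

theorem tvNormSub_self {X : Type*} [MeasurableSpace X] (μ : Measure X) : tvNormSub μ μ = 0 := by
  simp [tvNormSub]

/-- A lower bound on the overlap of two probability measures bounds their distance in total
variation. -/
theorem tvNormSub_le_of_overlap {X : Type*} [MeasurableSpace X] {μ ν : Measure X}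
    [IsProbabilityMeasure μ] [IsProbabilityMeasure ν] {c : ℝ}
    (h : ∀ F G : X → ℝ≥0∞, Measurable F → Measurable G → (∀ z, F z ≤ 1) → (∀ z, G z ≤ 1) →
      (∀ z, 1 ≤ F z + G z) → ENNReal.ofReal c ≤ ∫⁻ z, F z ∂μ + ∫⁻ z, G z ∂ν) :
    tvNormSub μ ν ≤ 2 * (1 - c) := by
  have key : ∀ f : X → ℝ, Measurable f → (∀ x, |f x| ≤ 1) →
      ∫ x, f x ∂ν - ∫ x, f x ∂μ ≤ 2 * (1 - c) := by
    intro f hf hf1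
    have hle : ∀ x, -1 ≤ f x ∧ f x ≤ 1 := fun x => abs_le.1 (hf1 x)
    have hint : ∀ ρ : Measure X, IsProbabilityMeasure ρ → Integrable f ρ := fun ρ _ =>
      Integrable.of_bound hf.aestronglyMeasurable 1 (Filter.Eventually.of_forall hf1)
    have hμ := hint μ inferInstance
    have hν := hint ν inferInstance
    have hF : ∀ x, 0 ≤ (1 + f x) / 2 := fun x => by linarith [hle x]
    have hG : ∀ x, 0 ≤ (1 - f x) / 2 := fun x => by linarith [hle x]
    -- The test pair `(1 ± f) / 2` sums to 1, and its overlap is `1 - (∫ f dν - ∫ f dμ) / 2`.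
    have := h (fun x => ENNReal.ofReal ((1 + f x) / 2)) (fun x => ENNReal.ofReal ((1 - f x) / 2))
      ((hf.const_add 1).div_const 2).ennreal_ofReal ((hf.const_sub 1).div_const 2).ennreal_ofReal
      (fun x => ENNReal.ofReal_le_one.2 (by linarith [hle x]))
      (fun x => ENNReal.ofReal_le_one.2 (by linarith [hle x]))
      (fun x => by
        rw [← ENNReal.ofReal_add (hF x) (hG x), ← ENNReal.ofReal_one]
        exact ENNReal.ofReal_le_ofReal (by linarith))
    have hiF : Integrable (fun x => (1 + f x) / 2) μ := ((integrable_const 1).add hμ).div_const 2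
    have hiG : Integrable (fun x => (1 - f x) / 2) ν := ((integrable_const 1).sub hν).div_const 2
    rw [← ofReal_integral_eq_lintegral_ofReal hiF (Filter.Eventually.of_forall hF),
      ← ofReal_integral_eq_lintegral_ofReal hiG (Filter.Eventually.of_forall hG),
      ← ENNReal.ofReal_add (integral_nonneg hF) (integral_nonneg hG),
      ENNReal.ofReal_le_ofReal_iff (add_nonneg (integral_nonneg hF) (integral_nonneg hG)),
      integral_div, integral_div, integral_add (integrable_const 1) hμ,
      integral_sub (integrable_const 1) hν] at this
    simp only [integral_const, probReal_univ, smul_eq_mul, mul_one] at this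
    linarith
  have : Nonempty {f : X → ℝ // Measurable f ∧ ∀ x, |f x| ≤ 1} :=
    ⟨⟨fun _ => 0, measurable_const, by simp⟩⟩
  refine ciSup_le fun f => abs_le.2 ⟨?_, ?_⟩
  · linarith [key f.1 f.2.1 f.2.2]
  · have := key (fun x => -f.1 x) f.2.1.neg (by simpa using f.2.2)
    rw [integral_neg, integral_neg] at this
    linarith

/-! ### Constants and conclusion -/

theorem RegularPotential.pos_of_curvatureAtInfinity {d : ℕ} {U : E d → ℝ} {L : ℝ}
    (hU : RegularPotential U L) (hcurv : CurvatureAtInfinity U) (hd : d ≠ 0) : 0 < L := by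
  obtain ⟨m, K, hm, hK, h⟩ := hcurv
  set e : E d := EuclideanSpace.single ⟨0, Nat.pos_of_ne_zero hd⟩ 1 with he
  have he1 : ‖e‖ = 1 := by simp [he]
  have h1 := h (K • e) e (by simp [norm_smul, he1, abs_of_nonneg hK]) he1
  have h2 := (iteratedFDeriv ℝ 2 U (K • e)).le_opNorm ![e, e]
  simp only [Fin.prod_univ_two, Matrix.cons_val_zero, Matrix.cons_val_one, he1, mul_one] at h2
  linarith [hU.norm_hessian_le (K • e), (Real.le_norm_self _).trans h2]

/-- The squared argument of the distribution function is `(1 + 1/L) * 3L * K² = 3(L + 1)K²`, which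
the tail bound halves in the exponent. -/
theorem eps_half_le {L K : ℝ} (hL : 0 < L) (hK : 0 ≤ K) :
    eps L K / 2 ≤ Real.exp (-(3 / 2 * ((L + 1) * K ^ 2))) / 2 := by
  have h := cdf_gaussianReal_neg_le
    (show 0 ≤ Real.sqrt (1 + 1 / L) * Real.sqrt (3 * L) * K by positivity)
  unfold eps
  rw [mul_div_cancel_left₀ _ two_ne_zero]
  refine h.trans_eq ?_
  rw [mul_pow, mul_pow, Real.sq_sqrt (by positivity), Real.sq_sqrt (by positivity)]
  congr 2
  field_simp

theorem eps_half_le_one (L K : ℝ) : eps L K / 2 ≤ 1 := by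
  unfold eps
  rw [mul_div_cancel_left₀ _ two_ne_zero]
  exact cdf_le_one _ _

theorem mul_natCeil_le_two {γ : ℝ} (hγ : 0 < γ) (hγ1 : γ ≤ 1) : γ * ⌈1 / γ⌉₊ ≤ 2 := by
  have h1 := (Nat.ceil_lt_add_one (show 0 ≤ 1 / γ by positivity)).le
  calc γ * ⌈1 / γ⌉₊ ≤ γ * (1 / γ + 1) := by gcongr
    _ = 1 + γ := by field_simp
    _ ≤ 2 := by linarith

theorem one_le_mul_natCeil {γ : ℝ} (hγ : 0 < γ) : 1 ≤ γ * ⌈1 / γ⌉₊ := by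
  rw [mul_comm, ← div_le_iff₀ hγ]
  exact Nat.le_ceil _

/-- Overlap of the laws of MALA started from two points of a ball, after a unit of time. -/
theorem RegularPotential.exists_overlap_malaKernel {d : ℕ} {U : E d → ℝ} {L K c : ℝ}
    (hU : RegularPotential U L) (hc0 : 0 ≤ c) (hc : c < Real.exp (-((L + 1) * K ^ 2)) / 2) :
    ∃ Γ : ℝ, 0 < Γ ∧ ∀ γ : ℝ, 0 < γ → γ ≤ Γ → ∀ x y : E d, ‖x‖ ≤ K → ‖y‖ ≤ K →
      ∀ F G : E d → ℝ≥0∞, Measurable F → Measurable G → (∀ z, F z ≤ 1) → (∀ z, G z ≤ 1) →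
      (∀ z, 1 ≤ F z + G z) → ENNReal.ofReal c ≤
        ∫⁻ z, F z ∂((malaKernel U hU.contDiff γ ^ ⌈1 / γ⌉₊) x) +
        ∫⁻ z, G z ∂((malaKernel U hU.contDiff γ ^ ⌈1 / γ⌉₊) y) := by
  have hL := hU.nonneg
  set c₁ : ℝ := Real.exp (-((L + 1) * K ^ 2)) / 2 with hc₁
  set D : ℝ := 2 * L + L ^ 2 + 8 * 2 ^ ((d : ℝ) / 2) with hD
  have hD0 : 0 ≤ D := by positivity
  -- Each starting point costs at most `2 * η * exp (2 * D) * (1 + K ^ 2)`, since `γ * n ≤ 2`; this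
  -- equals half of the gap `c₁ - c`.
  set η : ℝ := (c₁ - c) / (4 * Real.exp (2 * D) * (1 + K ^ 2)) with hη
  have hη0 : 0 < η := div_pos (sub_pos.2 hc) (by positivity)
  obtain ⟨Γ, hΓ0, hΓ1, hΓ⟩ := hU.exists_rejection_le hη0
  refine ⟨min Γ (1 / (L ^ 2 + 1)), by positivity,
    fun γ hγ hγΓ x y hx hy F G hF hG hF1 hG1 hFG => ?_⟩
  have hγΓ' : γ ≤ Γ := hγΓ.trans (min_le_left _ _)
  have hγ1 : γ ≤ 1 := hγΓ'.trans hΓ1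
  have hγL : γ * L ^ 2 ≤ 1 := by
    have := (le_div_iff₀ (by positivity)).1 (hγΓ.trans (min_le_right _ _))
    linarith
  set n := ⌈1 / γ⌉₊ with hn
  have hn2 : γ * n ≤ 2 := mul_natCeil_le_two hγ hγ1
  have herr : ∀ z : E d, ‖z‖ ≤ K →
      ENNReal.ofReal (n * (η * γ) * (1 + D * γ) ^ n) * ENNReal.ofReal (1 + ‖z‖ ^ 2) ≤
        ENNReal.ofReal ((c₁ - c) / 2) := fun z hz => by
    rw [← ENNReal.ofReal_mul (by positivity)]
    refine ENNReal.ofReal_le_ofReal ?_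
    have hpow : (1 + D * γ) ^ n ≤ Real.exp (2 * D) := by
      calc (1 + D * γ) ^ n ≤ Real.exp (D * γ) ^ n := by
            gcongr
            linarith [Real.add_one_le_exp (D * γ)]
        _ = Real.exp (D * (γ * n)) := by rw [← Real.exp_nat_mul]; congr 1; ring
        _ ≤ Real.exp (D * 2) := by gcongr
        _ = _ := by rw [mul_comm]
    calc (n : ℝ) * (η * γ) * (1 + D * γ) ^ n * (1 + ‖z‖ ^ 2)
        = η * (γ * n) * (1 + D * γ) ^ n * (1 + ‖z‖ ^ 2) := by ring
      _ ≤ η * 2 * Real.exp (2 * D) * (1 + K ^ 2) := by gcongr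
      _ = (c₁ - c) / 2 := by rw [hη]; field_simp; ring
  have hF' := (hU.ulaOp_iterate_le hγ hγ1 hη0.le (hΓ γ hγ hγΓ') hF hF1 n x).trans
    (add_le_add_right (herr x hx) _)
  have hG' := (hU.ulaOp_iterate_le hγ hγ1 hη0.le (hΓ γ hγ hγΓ') hG hG1 n y).trans
    (add_le_add_right (herr y hy) _)
  have hsum := (hU.half_exp_le_ulaOp_iterate hγ hγL (one_le_mul_natCeil hγ) hx hy hF hG hFG).trans
    (add_le_add hF' hG')
  have hpos : 0 ≤ (c₁ - c) / 2 := by linarith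
  rw [add_add_add_comm, ← ENNReal.ofReal_add hpos hpos, add_halves, ← hc₁] at hsum
  rw [show c₁ = c + (c₁ - c) by ring, ENNReal.ofReal_add hc0 (by linarith),
    show c + (c₁ - c) - c = c₁ - c by ring] at hsum
  exact (ENNReal.add_le_add_iff_right ENNReal.ofReal_ne_top).1 hsum

end MALA

theorem mainTheorem6 {d : ℕ} (U : MALA.E d → ℝ) (L : ℝ)
    (hU : MALA.RegularPotential U L) (hcurv : MALA.CurvatureAtInfinity U) :
    ∀ K : ℝ, 0 ≤ K → ∃ Γ : ℝ, 0 < Γ ∧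
      ∀ x y : MALA.E d, max ‖x‖ ‖y‖ ≤ K → ∀ γ : ℝ, 0 < γ → γ ≤ Γ →
        MALA.tvNormSub ((MALA.malaKernel U hU.contDiff γ ^ ⌈1 / γ⌉₊) x)
            ((MALA.malaKernel U hU.contDiff γ ^ ⌈1 / γ⌉₊) y) ≤
          2 * (1 - MALA.eps L K / 2) := by
  intro K hK
  -- For `K = 0` there is no strict gap to absorb the rejection error, but the starting points
  -- coincide, as they do when `d = 0`.
  by_cases htriv : d = 0 ∨ K = 0
  · refine ⟨1, one_pos, fun x y hxy γ _ _ => ?_⟩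
    have : x = y := by
      rcases htriv with rfl | rfl
      · exact Subsingleton.elim x y
      · rw [norm_le_zero_iff.1 ((le_max_left _ _).trans hxy),
          norm_le_zero_iff.1 ((le_max_right _ _).trans hxy)]
    rw [this, MALA.tvNormSub_self]
    linarith [MALA.eps_half_le_one L K]
  · rw [not_or] at htriv
    have hL := hU.pos_of_curvatureAtInfinity hcurv htriv.1
    have hK0 : 0 < K := lt_of_le_of_ne hK (Ne.symm htriv.2)
    have hc : Real.exp (-(3 / 2 * ((L + 1) * K ^ 2))) / 2 <
        Real.exp (-((L + 1) * K ^ 2)) / 2 := by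
      have : 0 < (L + 1) * K ^ 2 := by positivity
      have h := Real.exp_lt_exp.2
        (show -(3 / 2 * ((L + 1) * K ^ 2)) < -((L + 1) * K ^ 2) by linarith)
      linarith
    obtain ⟨Γ, hΓ0, hΓ⟩ := hU.exists_overlap_malaKernel (by positivity) hc
    refine ⟨Γ, hΓ0, fun x y hxy γ hγ hγΓ => ?_⟩
    have := MALA.isMarkovKernel_malaKernel hU.contDiff hγ
    have := MALA.isMarkovKernel_pow (MALA.malaKernel U hU.contDiff γ) ⌈1 / γ⌉₊
    refine (MALA.tvNormSub_le_of_overlap (hΓ γ hγ hγΓ x y ((le_max_left _ _).trans hxy)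
      ((le_max_right _ _).trans hxy))).trans ?_
    linarith [MALA.eps_half_le hL hK]
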